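/- Let $\mathbf u$ be a planar vector field, continuous in a neighbourhood of the origin of $\mathbb R^2$, of the form $$\mathbf u(x,y)=\bigl(\alpha y+\lambda x^k+f(x,y),\ \ \beta x^n-\lambda k\,y\,x^{k-1}+g(x,y)\bigr)$$ near $0$, where $n,k\ge 2$ are integers, $\alpha,\beta,\lambda$ are nonzero real numbers and, as $(x,y)\to 0$, $$f(x,y)=O(|x|^{k+1})+y\,O(|x|)+O(y^2),\qquad g(x,y)=O(|x|^{n+1})+y\,O(|x|^{k})+O(y^2).$$ Consider the assumptions - (S1) $2k>n+1$ and $n$ is even; - (S2) $2k>n+1$, $n$ is odd and $\alpha\beta>0$; - (S3) $2k>n+1$, $n$ is odd and $\alpha\beta<0$; - (S4) $2k=n+1$ and $\lambda^2k+\alpha\beta>0$; - (S6) $2k=n+1$ and $\lambda^2k+\alpha\beta<0$; - (S7) $2k<n+1$. If one of them holds, then $0$ is an isolated zero of $\mathbf u$, and its index $\operatorname{ind}(\mathbf u,0)$, i.e. the degree of the map $\omega\mapsto \mathbf u(r\omega)/|\mathbf u(r\omega)|$ of the unit circle to itself for all sufficiently small $r>0$, is $$\operatorname{ind}(\mathbf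 u,0)=\begin{cases}0,&\text{if (S1) holds},\\-1,&\text{if (S2), (S4) or (S7) holds},\\ 1,&\text{if (S3) or (S6) holds}.\end{cases}$$ -/

import Mathlib

open Filter Topology Asymptotics

/-- The Euclidean plane; `p 0` and `p 1` are the coordinates `x` and `y`. -/
abbrev Plane : Type := EuclideanSpace ℝ (Fin 2)

/-- The point of the unit circle at angle `t`. -/
noncomputable def circlePt (t : ℝ) : Plane := !₂[Real.cos t, Real.sin t]

/-- `φ` restricts to a continuous map of the unit circle to itself of (Brouwer) degree `d`:
it has a continuous lift `θ` to the universal cover which advances by `d` full turns along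
one turn of the circle. -/
def HasCircleDegree (φ : Plane → Plane) (d : ℤ) : Prop :=
  ∃ θ : ℝ → ℝ, Continuous θ ∧ (∀ t, φ (circlePt t) = circlePt (θ t)) ∧
    ∀ t, θ (t + 2 * Real.pi) = θ t + d * (2 * Real.pi)

/-- `x₀` is an isolated zero of the vector field `u`, which is continuous near `x₀`, and the
index of `u` at `x₀` is `d`: on every sufficiently small circle around `x₀` the normalized field
`ω ↦ u (x₀ + r ω) / ‖u (x₀ + r ω)‖` has degree `d` as a map of the unit circle to itself. -/
def HasIndex (u : Plane → Plane) (x₀ : Plane) (d : ℤ) : Prop :=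
  u x₀ = 0 ∧ ∃ R : ℝ, 0 < R ∧ ContinuousOn u (Metric.ball x₀ R) ∧
    (∀ x ∈ Metric.ball x₀ R, u x = 0 → x = x₀) ∧
    ∀ r : ℝ, 0 < r → r < R →
      HasCircleDegree (fun ω => ‖u (x₀ + r • ω)‖⁻¹ • u (x₀ + r • ω)) d

/-- Near the origin, `u (x, y) = (α y + lam x ^ k + f, β x ^ n - lam k y x ^ (k - 1) + g)` with
`f = O(|x| ^ (k + 1)) + y O(|x|) + O(y ^ 2)` and
`g = O(|x| ^ (n + 1)) + y O(|x| ^ k) + O(y ^ 2)` as `(x, y) → 0`. -/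
def HasTaylorForm (u : Plane → Plane) (α β lam : ℝ) (n k : ℕ) : Prop :=
  ∃ f f₁ f₂ f₃ g g₁ g₂ g₃ : Plane → ℝ,
    (∀ᶠ p in 𝓝 (0 : Plane), u p =
      !₂[α * p 1 + lam * p 0 ^ k + f p, β * p 0 ^ n - lam * k * p 1 * p 0 ^ (k - 1) + g p]) ∧
    (∀ᶠ p in 𝓝 (0 : Plane), f p = f₁ p + p 1 * f₂ p + f₃ p) ∧
    (f₁ =O[𝓝 0] fun p => |p 0| ^ (k + 1)) ∧
    (f₂ =O[𝓝 0] fun p => |p 0|) ∧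
    (f₃ =O[𝓝 0] fun p => p 1 ^ 2) ∧
    (∀ᶠ p in 𝓝 (0 : Plane), g p = g₁ p + p 1 * g₂ p + g₃ p) ∧
    (g₁ =O[𝓝 0] fun p => |p 0| ^ (n + 1)) ∧
    (g₂ =O[𝓝 0] fun p => |p 0| ^ k) ∧
    (g₃ =O[𝓝 0] fun p => p 1 ^ 2)

/-- The degree of a self-map of the circle is unique. -/
theorem HasCircleDegree.unique {φ : Plane → Plane} {d e : ℤ}
    (hd : HasCircleDegree φ d) (he : HasCircleDegree φ e) : d = e := by
  obtain ⟨θ, hθ, h1, h2⟩ := hd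
  obtain ⟨η, hη, h3, h4⟩ := he
  have hpi : (0 : ℝ) < 2 * Real.pi := by positivity
  have key : ∀ t, ∃ m : ℤ, (θ t - η t) / (2 * Real.pi) = m := by
    intro t
    have h : circlePt (θ t) = circlePt (η t) := by rw [← h1, ← h3]
    have hc : Real.cos (θ t) = Real.cos (η t) := by
      simpa [circlePt] using congrArg (fun p : Plane => p 0) h
    have hs : Real.sin (θ t) = Real.sin (η t) := by
      simpa [circlePt] using congrArg (fun p : Plane => p 1) h
    obtain ⟨m, hm⟩ := Real.Angle.angle_eq_iff_two_pi_dvd_sub.1 (Real.Angle.cos_sin_inj hc hs)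
    exact ⟨m, by rw [hm]; field_simp⟩
  choose m hm using key
  have hcont : Continuous m := by
    refine Int.isClosedEmbedding_coe_real.isEmbedding.continuous_iff.2 ?_
    have : ((fun z : ℤ => (z : ℝ)) ∘ m) = fun t => (θ t - η t) / (2 * Real.pi) := by
      funext t
      exact (hm t).symm
    rw [this]
    fun_prop
  have hconst : m (0 + 2 * Real.pi) = m 0 :=
    PreconnectedSpace.constant inferInstance hcont
  have e1 := hm (0 + 2 * Real.pi)
  rw [hconst, ← hm 0, h2, h4, div_left_inj' hpi.ne'] at e1
  have e2 : (d : ℝ) * (2 * Real.pi) = e * (2 * Real.pi) := by linarith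
  exact_mod_cast mul_right_cancel₀ hpi.ne' e2

/-- The index is unique. -/
theorem HasIndex.unique {u : Plane → Plane} {x₀ : Plane} {d e : ℤ}
    (hd : HasIndex u x₀ d) (he : HasIndex u x₀ e) : d = e := by
  obtain ⟨-, R, hR, -, -, h⟩ := hd
  obtain ⟨-, S, hS, -, -, h'⟩ := he
  have hm : 0 < min R S := lt_min hR hS
  have h1 := min_le_left R S
  have h2 := min_le_right R S
  exact (h (min R S / 2) (by linarith) (by linarith)).unique
    (h' (min R S / 2) (by linarith) (by linarith))

/-! On the zero set of `u₀` near the origin one has `y = -(lam / α) x ^ k + o(x ^ k)`, so that there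
`u₁ = β x ^ n + (lam ^ 2 k / α) x ^ (2 k - 1) + o(x ^ m) ~ c x ^ m`, with `c x ^ m` the leading term
of the first two summands. Hence, on small circles, `u` can be deformed without zeros, one
coordinate at a time, into the field `(α y, c x ^ m)`. On the circle, that field is in turn
deformable into the constant `(0, c)` if `m` is even, and into the isometry
`(sign α • y, sign c • x)`, which has degree `-sign (α c)`, if `m` is odd. -/

theorem continuous_circlePt : Continuous circlePt := by
  unfold circlePt
  fun_prop

theorem norm_circlePt (t : ℝ) : ‖circlePt t‖ = 1 := by
  simp [EuclideanSpace.norm_eq, circlePt]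

theorem circlePt_mem_sphere (t : ℝ) : circlePt t ∈ Metric.sphere (0 : Plane) 1 := by
  simpa using norm_circlePt t

theorem circlePt_add_two_pi (t : ℝ) : circlePt (t + 2 * Real.pi) = circlePt t := by
  simp [circlePt]

theorem repr_ofReal_mul_exp_mul_I (r t : ℝ) :
    Complex.orthonormalBasisOneI.repr (r * Complex.exp (t * Complex.I)) = r • circlePt t := by
  ext i
  fin_cases i <;>
    simp [circlePt, Complex.orthonormalBasisOneI_repr_apply, Complex.exp_ofReal_mul_I_re,
      Complex.exp_ofReal_mul_I_im]

theorem repr_mul_exp_mul_I (z : ℂ) (t : ℝ) :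
    Complex.orthonormalBasisOneI.repr (z * Complex.exp (t * Complex.I)) =
      ‖z‖ • circlePt (t + z.arg) := by
  rw [← repr_ofReal_mul_exp_mul_I, Complex.ofReal_add, add_comm (t : ℂ), add_mul, Complex.exp_add,
    ← mul_assoc, Complex.norm_mul_exp_arg_mul_I]

theorem Plane.eq_zero {p : Plane} (h₀ : p 0 = 0) (h₁ : p 1 = 0) : p = 0 := by
  ext i
  fin_cases i
  · exact h₀
  · exact h₁

theorem zero_notMem_segment_of_apply {ι : Type*} {p q : EuclideanSpace ℝ ι} {i j : ι}
    (hi : p i = q i) (hj : p i = 0 → 0 < p j * q j) : 0 ∉ segment ℝ p q := by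
  rintro ⟨a, b, ha, hb, hab, h⟩
  have hcoord : ∀ l, a * p l + b * q l = 0 := fun l => by simpa using congrArg (fun x => x l) h
  have hpi : p i = 0 := by
    simpa only [← hi, ← add_mul, hab, one_mul] using hcoord i
  have hpos := hj hpi
  have hsum : a * p j ^ 2 + b * (p j * q j) = 0 := by linear_combination p j * hcoord j
  have hp : 0 < p j ^ 2 := pow_two_pos_of_ne_zero (left_ne_zero_of_mul hpos.ne')
  rcases ha.eq_or_lt with rfl | ha
  · obtain rfl : b = 1 := by simpa using hab
    linarith
  · nlinarith [mul_pos ha hp, mul_nonneg hb hpos.le]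

/-- The winding number of the vector field `v` along the unit circle is `d`. In particular, `v`
has no zero on the unit circle, since there `‖v ω‖⁻¹ • v ω` is a unit vector. -/
def HasWinding (v : Plane → Plane) (d : ℤ) : Prop :=
  HasCircleDegree (fun ω => ‖v ω‖⁻¹ • v ω) d

namespace HasWinding

variable {v w : Plane → Plane} {d : ℤ}

theorem of_polar {θ ρ : ℝ → ℝ} (hθ : Continuous θ) (hρ : ∀ t, 0 < ρ t)
    (hv : ∀ t, v (circlePt t) = ρ t • circlePt (θ t))
    (hper : ∀ t, θ (t + 2 * Real.pi) = θ t + d * (2 * Real.pi)) : HasWinding v d := by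
  refine ⟨θ, hθ, fun t => ?_, hper⟩
  simp only [hv, norm_smul, norm_circlePt, mul_one, Real.norm_of_nonneg (hρ t).le,
    inv_smul_smul₀ (hρ t).ne']

theorem exists_polar (h : HasWinding v d) :
    ∃ θ : ℝ → ℝ, Continuous θ ∧
      (∀ t, v (circlePt t) = ‖v (circlePt t)‖ • circlePt (θ t)) ∧
      ∀ t, θ (t + 2 * Real.pi) = θ t + d * (2 * Real.pi) := by
  obtain ⟨θ, hθ, hlift, hper⟩ := h
  have hne : ∀ t, v (circlePt t) ≠ 0 := fun t h0 => by
    simpa [h0, norm_circlePt] using congrArg norm (hlift t)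
  refine ⟨θ, hθ, fun t => ?_, hper⟩
  rw [← hlift, smul_inv_smul₀ (norm_ne_zero_iff.2 (hne t))]

/-- The angle from `v` to `w` stays in `(-π, π)`, so it is a continuous periodic function
of `t` which can be added to the polar angle of `v`. -/
theorem of_zero_notMem_segment (h : HasWinding v d)
    (hw : ContinuousOn w (Metric.sphere 0 1))
    (hne : ∀ ω ∈ Metric.sphere (0 : Plane) 1, 0 ∉ segment ℝ (v ω) (w ω)) : HasWinding w d := by
  obtain ⟨θ, hθ, hpolar, hper⟩ := h.exists_polar
  let L := Complex.orthonormalBasisOneI.repr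
  let z : ℝ → ℂ := fun t => L.symm (w (circlePt t)) * Complex.exp (-θ t * Complex.I)
  have hwz : ∀ t, w (circlePt t) = L (z t * Complex.exp (θ t * Complex.I)) := fun t => by
    simp only [z, mul_assoc, ← Complex.exp_add, neg_mul, neg_add_cancel, Complex.exp_zero, mul_one,
      LinearIsometryEquiv.apply_symm_apply]
  have hz : Continuous z := by
    have hwc : Continuous fun t => w (circlePt t) :=
      hw.comp_continuous continuous_circlePt circlePt_mem_sphere
    exact (L.symm.continuous.comp hwc).mul (by fun_prop)
  have hslit : ∀ t, z t ∈ Complex.slitPlane := fun t => by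
    rw [Complex.mem_slitPlane_iff_not_le_zero, Complex.le_def]
    rintro ⟨hre, him⟩
    have hw_eq : w (circlePt t) = (z t).re • circlePt (θ t) := by
      rw [hwz, ← repr_ofReal_mul_exp_mul_I, ← Complex.ext (z := z t) (w := (z t).re) rfl him]
    refine hne _ (circlePt_mem_sphere t) (mem_segment_iff_sameRay.2 ?_)
    rw [hpolar t, hw_eq, zero_sub, sub_zero, ← neg_smul_neg (z t).re, ← smul_neg]
    exact (SameRay.sameRay_nonneg_smul_left _ (norm_nonneg _)).nonneg_smul_right
      (neg_nonneg.2 hre)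
  refine of_polar (θ := fun t => θ t + (z t).arg) (ρ := fun t => ‖z t‖) ?_
    (fun t => norm_pos_iff.2 (Complex.slitPlane_ne_zero (hslit t))) (fun t => ?_) fun t => ?_
  · exact hθ.add <| continuous_iff_continuousAt.2 fun t =>
      (Complex.continuousAt_arg (hslit t)).comp hz.continuousAt
  · rw [hwz, repr_mul_exp_mul_I]
  · have hz_per : z (t + 2 * Real.pi) = z t := by
      simp only [z, circlePt_add_two_pi, hper]
      congr 1
      rw [Complex.exp_eq_exp_iff_exists_int]
      exact ⟨-d, by push_cast; ring⟩
    rw [hz_per, hper]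
    ring

/-- Both straight-line homotopies, from `(w₀, w₁)` to `(v₀, w₁)` and on to `(v₀, v₁)`, avoid the
origin. -/
theorem of_sign (h : HasWinding w d)
    (hv : ContinuousOn v (Metric.sphere 0 1)) (hw : ContinuousOn w (Metric.sphere 0 1))
    (h₁ : ∀ ω ∈ Metric.sphere 0 1, v ω 0 = 0 → 0 < w ω 1 * v ω 1)
    (h₀ : ∀ ω ∈ Metric.sphere 0 1, w ω 1 = 0 → 0 < w ω 0 * v ω 0) : HasWinding v d := by
  have hmid : ContinuousOn (fun ω => !₂[v ω 0, w ω 1]) (Metric.sphere 0 1) := by fun_prop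
  have hmid_winding : HasWinding (fun ω => !₂[v ω 0, w ω 1]) d :=
    h.of_zero_notMem_segment hmid fun ω hω =>
      zero_notMem_segment_of_apply (i := 1) (j := 0) rfl (h₀ ω hω)
  exact hmid_winding.of_zero_notMem_segment hv fun ω hω =>
    zero_notMem_segment_of_apply (i := 0) (j := 1) rfl (h₁ ω hω)

end HasWinding

theorem hasWinding_const {p : Plane} (hp : p ≠ 0) : HasWinding (fun _ => p) 0 := by
  let L := Complex.orthonormalBasisOneI.repr
  have hpolar : p = ‖L.symm p‖ • circlePt (L.symm p).arg := by
    simpa only [L, LinearIsometryEquiv.apply_symm_apply, Complex.ofReal_zero, zero_mul,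
      Complex.exp_zero, mul_one, zero_add] using repr_mul_exp_mul_I (L.symm p) 0
  exact HasWinding.of_polar continuous_const (fun _ => norm_pos_iff.2 (by simpa using hp))
    (fun _ => hpolar) (by simp)

theorem hasWinding_swap_sign {a c : ℝ} (ha : a ≠ 0) (hc : c ≠ 0) :
    HasWinding (fun ω => !₂[SignType.sign a * ω 1, SignType.sign c * ω 0])
      (-SignType.sign (a * c)) := by
  refine HasWinding.of_polar (ρ := fun _ => 1) (θ := fun t =>
      SignType.sign c * (Real.pi / 2) - SignType.sign a * SignType.sign c * t)
    (by fun_prop) (fun _ => one_pos) (fun φ => ?_) fun φ => by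
      rw [sign_mul]; push_cast; ring
  rcases ha.lt_or_gt with ha | ha <;> rcases hc.lt_or_gt with hc | hc <;>
    ext i <;> fin_cases i <;>
    simp [ha, hc, circlePt, Real.cos_add, Real.cos_sub, Real.sin_add, Real.sin_sub]

theorem hasWinding_pow {a c : ℝ} (ha : a ≠ 0) (hc : c ≠ 0) (m : ℕ) :
    HasWinding (fun ω => !₂[a * ω 1, c * ω 0 ^ m])
      (if Even m then 0 else -SignType.sign (a * c)) := by
  have hcont : ContinuousOn (fun ω : Plane => (!₂[a * ω 1, c * ω 0 ^ m] : Plane))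
      (Metric.sphere 0 1) := by fun_prop
  have hne : ∀ ω ∈ Metric.sphere (0 : Plane) 1, ω 1 = 0 → ω 0 ≠ 0 := fun ω hω hy hx => by
    simp [Plane.eq_zero hx hy] at hω
  have hx : ∀ ω ∈ Metric.sphere (0 : Plane) 1, a * ω 1 = 0 → ω 0 ≠ 0 := fun ω hω h =>
    hne ω hω ((mul_eq_zero.1 h).resolve_left ha)
  split_ifs with hm
  · have hp : (!₂[0, c] : Plane) ≠ 0 := fun h => hc (congrArg (fun p : Plane => p 1) h)
    refine (hasWinding_const hp).of_sign hcont continuousOn_const (fun ω hω h => ?_)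
      fun _ _ h => (hc h).elim
    calc 0 < c ^ 2 * ω 0 ^ m := mul_pos (by positivity) (hm.pow_pos (hx ω hω h))
      _ = c * (c * ω 0 ^ m) := by ring
  · rw [Nat.not_even_iff_odd] at hm
    have ha_abs : 0 < SignType.sign a * a := by rwa [sign_mul_self, abs_pos]
    have hc_abs : 0 < SignType.sign c * c := by rwa [sign_mul_self, abs_pos]
    refine (hasWinding_swap_sign ha hc).of_sign hcont (by fun_prop) (fun ω hω h => ?_)
      fun ω hω h => ?_
    · calc (0 : ℝ) < (SignType.sign c * c) * ω 0 ^ (m + 1) :=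
            mul_pos hc_abs (hm.add_one.pow_pos (hx ω hω h))
        _ = SignType.sign c * ω 0 * (c * ω 0 ^ m) := by ring
    · have hx0 : ω 0 = 0 := (mul_eq_zero.1 h).resolve_left (left_ne_zero_of_mul hc_abs.ne')
      have hy : ω 1 ≠ 0 := fun hy => hne ω hω hy hx0
      calc (0 : ℝ) < (SignType.sign a * a) * ω 1 ^ 2 := by positivity
        _ = SignType.sign a * ω 1 * (a * ω 1) := by ring

theorem add_smul_mem_sphere {E : Type*} [SeminormedAddCommGroup E] [NormedSpace ℝ E] {x₀ ω : E}
    {r : ℝ} (hr : 0 ≤ r) (hω : ω ∈ Metric.sphere (0 : E) 1) :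
    x₀ + r • ω ∈ Metric.sphere x₀ r := by
  simp_all [norm_smul, abs_of_nonneg hr]

theorem HasIndex.of_sign {u w : Plane → Plane} {x₀ : Plane} {d : ℤ} (h : HasIndex w x₀ d)
    (hu : ∀ᶠ p in 𝓝 x₀, ContinuousAt u p) (h0 : u x₀ = 0)
    (h₁ : ∀ᶠ p in 𝓝[≠] x₀, u p 0 = 0 → 0 < w p 1 * u p 1)
    (h₀ : ∀ᶠ p in 𝓝[≠] x₀, w p 1 = 0 → 0 < w p 0 * u p 0) : HasIndex u x₀ d := by
  obtain ⟨-, S, hS, hw, -, hdeg⟩ := h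
  obtain ⟨T, hT, hball⟩ := Metric.eventually_nhds_iff_ball.1
    (hu.and (eventually_nhdsWithin_iff.1 (h₁.and h₀)))
  have hucont : ContinuousOn u (Metric.ball x₀ T) := fun p hp =>
    (hball p hp).1.continuousWithinAt
  have hwinding : ∀ r, 0 < r → r < min S T → HasWinding (fun ω => u (x₀ + r • ω)) d := by
    intro r hr hrR
    obtain ⟨hrS, hrT⟩ := lt_min_iff.1 hrR
    have hsphere : ∀ ω ∈ Metric.sphere (0 : Plane) 1, x₀ + r • ω ∈ Metric.sphere x₀ r :=
      fun ω => add_smul_mem_sphere hr.le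
    have hsign := fun ω hω =>
      (hball (x₀ + r • ω) (Metric.sphere_subset_ball hrT (hsphere ω hω))).2
        (Metric.ne_of_mem_sphere (hsphere ω hω) hr.ne')
    refine HasWinding.of_sign (hdeg r hr hrS) ?_ ?_ (fun ω hω => (hsign ω hω).1)
      fun ω hω => (hsign ω hω).2
    · exact hucont.comp (by fun_prop) fun ω hω => Metric.sphere_subset_ball hrT (hsphere ω hω)
    · exact hw.comp (by fun_prop) fun ω hω => Metric.sphere_subset_ball hrS (hsphere ω hω)
  have hsub : Metric.ball x₀ (min S T) ⊆ Metric.ball x₀ T :=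
    Metric.ball_subset_ball (min_le_right S T)
  refine ⟨h0, min S T, lt_min hS hT, hucont.mono hsub, fun p hp hup => ?_, hwinding⟩
  by_contra hne
  simpa [hup] using (hball p (hsub hp)).2 hne

theorem hasIndex_pow {a c : ℝ} (ha : a ≠ 0) (hc : c ≠ 0) {m : ℕ} (hm : m ≠ 0) :
    HasIndex (fun p => !₂[a * p 1, c * p 0 ^ m]) 0
      (if Even m then 0 else -SignType.sign (a * c)) := by
  refine ⟨?_, 1, one_pos, by fun_prop, fun p _ hp => ?_, fun r hr _ => ?_⟩
  · exact Plane.eq_zero (by simp) (by simp [hm])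
  · have h₁ := congrArg (fun p : Plane => p 0) hp
    have h₂ := congrArg (fun p : Plane => p 1) hp
    exact Plane.eq_zero (by simpa [hc, hm] using h₂) (by simpa [ha] using h₁)
  · have hscale : (fun ω : Plane => (!₂[a * (0 + r • ω) 1, c * (0 + r • ω) 0 ^ m] : Plane)) =
        fun ω => !₂[r * a * ω 1, r ^ m * c * ω 0 ^ m] := by
      funext ω
      simp only [zero_add, PiLp.smul_apply, smul_eq_mul, mul_pow, mul_left_comm, mul_assoc]
    have hsign : SignType.sign (r * a * (r ^ m * c)) = SignType.sign (a * c) := by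
      rw [mul_mul_mul_comm, sign_mul, sign_pos (by positivity), one_mul]
    have hw := hasWinding_pow (mul_ne_zero hr.ne' ha) (mul_ne_zero (pow_ne_zero m hr.ne') hc) m
    rwa [hsign, ← hscale] at hw

theorem eventually_mul_pos_of_isEquivalent {X : Type*} {l : Filter X} {f g : X → ℝ}
    (h : f ~[l] g) : ∀ᶠ x in l, g x ≠ 0 → 0 < g x * f x := by
  obtain ⟨φ, hφ, hfg⟩ := h.exists_pos_eq_mul
  filter_upwards [hφ, hfg] with x hφx hfx hgx
  calc 0 < φ x * g x ^ 2 := by positivity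
    _ = g x * f x := by rw [hfx, Pi.mul_apply]; ring

theorem Plane.tendsto_coord (i : Fin 2) : Tendsto (fun p : Plane => p i) (𝓝 0) (𝓝 0) :=
  Continuous.tendsto' (by fun_prop) 0 0 rfl

theorem Plane.isLittleO_coord_pow {l m : ℕ} (h : m < l) (i : Fin 2) :
    (fun p : Plane => p i ^ l) =o[𝓝 0] fun p => p i ^ m :=
  (isLittleO_pow_pow h).comp_tendsto (Plane.tendsto_coord i)

namespace HasTaylorForm

variable {u : Plane → Plane} {α β lam c : ℝ} {n k m : ℕ}

theorem map_zero (hu : HasTaylorForm u α β lam n k) (hn : n ≠ 0) (hk : k ≠ 0) : u 0 = 0 := by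
  obtain ⟨f, f₁, f₂, f₃, g, g₁, g₂, g₃, hu, hf, hf₁, -, hf₃, hg, hg₁, -, hg₃⟩ := hu
  have hf0 : f 0 = 0 := by
    rw [hf.self_of_nhds, hf₁.eq_zero_imp.self_of_nhds (by simp),
      hf₃.eq_zero_imp.self_of_nhds (by simp)]
    simp
  have hg0 : g 0 = 0 := by
    rw [hg.self_of_nhds, hg₁.eq_zero_imp.self_of_nhds (by simp),
      hg₃.eq_zero_imp.self_of_nhds (by simp)]
    simp
  rw [hu.self_of_nhds]
  exact Plane.eq_zero (by simp [hf0, hk]) (by simp [hg0, hn])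

theorem isLittleO_fst (hu : HasTaylorForm u α β lam n k) :
    (fun p => u p 0 - (α * p 1 + lam * p 0 ^ k)) =o[𝓝 0] fun p => |p 0| ^ k + |p 1| := by
  obtain ⟨f, f₁, f₂, f₃, g, -, -, -, hu, hf, hf₁, hf₂, hf₃, -⟩ := hu
  have hxk : (fun p : Plane => p 0 ^ k) =O[𝓝 0] fun p => |p 0| ^ k + |p 1| :=
    isBigO_of_le _ fun p => by
      rw [norm_pow, Real.norm_eq_abs, Real.norm_of_nonneg (by positivity)]
      exact le_add_of_nonneg_right (abs_nonneg _)
  have hy : (fun p : Plane => p 1) =O[𝓝 0] fun p => |p 0| ^ k + |p 1| :=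
    isBigO_of_le _ fun p => by
      rw [Real.norm_eq_abs, Real.norm_of_nonneg (by positivity)]
      exact le_add_of_nonneg_left (by positivity)
  have h₁ : f₁ =o[𝓝 0] fun p => |p 0| ^ k + |p 1| := by
    simp only [← abs_pow, isBigO_abs_right] at hf₁
    exact (hf₁.trans_isLittleO (Plane.isLittleO_coord_pow k.lt_succ_self 0)).trans_isBigO hxk
  have h₂ : (fun p => p 1 * f₂ p) =o[𝓝 0] fun p => |p 0| ^ k + |p 1| := by
    have hf₂_zero : f₂ =o[𝓝 0] fun _ => (1 : ℝ) :=
      (isBigO_abs_right.1 hf₂).trans_isLittleO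
        ((isLittleO_one_iff ℝ).2 (Plane.tendsto_coord 0))
    simpa using hy.mul_isLittleO hf₂_zero
  have h₃ : f₃ =o[𝓝 0] fun p => |p 0| ^ k + |p 1| := by
    have hyy : (fun p : Plane => p 1 ^ 2) =o[𝓝 0] fun p => p 1 := by
      simpa using Plane.isLittleO_coord_pow one_lt_two 1
    exact (hf₃.trans_isLittleO hyy).trans_isBigO hy
  refine ((h₁.add h₂).add h₃).congr' ?_ EventuallyEq.rfl
  filter_upwards [hu, hf] with p hup hfp
  simp [hup, hfp]

theorem isEquivalent_fst_on_axis (hu : HasTaylorForm u α β lam n k) (hα : α ≠ 0) (hk : k ≠ 0) :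
    (fun p => u p 0) ~[𝓝[{p | p 0 = 0}] 0] fun p => α * p 1 := by
  have hsmall := hu.isLittleO_fst.mono (nhdsWithin_le_nhds (s := {p | p 0 = 0}))
  have hy : (fun p : Plane => |p 1|) =O[𝓝[{p | p 0 = 0}] 0] fun p => α * p 1 :=
    (isBigO_self_const_mul hα _ _).abs_left
  refine IsLittleO.trans_isBigO (hsmall.congr' ?_ ?_) hy <;>
    filter_upwards [self_mem_nhdsWithin] with p (hx : p 0 = 0) <;> simp [hx, hk]

theorem isBigO_snd_of_fst_eq_zero (hu : HasTaylorForm u α β lam n k) (hα : α ≠ 0) :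
    (fun p => p 1) =O[𝓝[{p | u p 0 = 0}] 0] fun p => p 0 ^ k := by
  have hα' : 0 < |α| := abs_pos.2 hα
  refine IsBigO.of_bound (1 + 2 * |lam| / |α|) ?_
  filter_upwards [self_mem_nhdsWithin,
    nhdsWithin_le_nhds (hu.isLittleO_fst.def (half_pos hα'))] with p (hup : u p 0 = 0) hp
  rw [hup, zero_sub, norm_neg, Real.norm_eq_abs, Real.norm_of_nonneg (by positivity)] at hp
  have hαy : |α| * |p 1| ≤ |α * p 1 + lam * p 0 ^ k| + |lam| * |p 0| ^ k := by
    rw [← abs_pow, ← abs_mul, ← abs_mul]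
    simpa using abs_sub (α * p 1 + lam * p 0 ^ k) (lam * p 0 ^ k)
  rw [Real.norm_eq_abs, norm_pow, Real.norm_eq_abs]
  calc |p 1| = 2 / |α| * (|α| * |p 1| - |α| / 2 * |p 1|) := by field_simp; ring
    _ ≤ 2 / |α| * (|α| / 2 * |p 0| ^ k + |lam| * |p 0| ^ k) := by gcongr; linarith
    _ = (1 + 2 * |lam| / |α|) * |p 0| ^ k := by field_simp

theorem isLittleO_snd_of_fst_eq_zero (hu : HasTaylorForm u α β lam n k) (hα : α ≠ 0) :
    (fun p => p 1 + lam / α * p 0 ^ k) =o[𝓝[{p | u p 0 = 0}] 0] fun p => p 0 ^ k := by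
  have hsum : (fun p : Plane => |p 0| ^ k + |p 1|) =O[𝓝[{p | u p 0 = 0}] 0]
      fun p => p 0 ^ k := by
    simp only [← abs_pow]
    exact (isBigO_refl _ _).abs_left.add (hu.isBigO_snd_of_fst_eq_zero hα).abs_left
  have hsmall := (hu.isLittleO_fst.mono nhdsWithin_le_nhds).trans_isBigO hsum
  refine (hsmall.const_mul_left (-α⁻¹)).congr' ?_ EventuallyEq.rfl
  filter_upwards [self_mem_nhdsWithin] with p (hup : u p 0 = 0)
  rw [hup]
  field_simp
  ring

theorem isLittleO_snd_remainder (hu : HasTaylorForm u α β lam n k) (hα : α ≠ 0) (hmn : m ≤ n)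
    (hmk : m < 2 * k) :
    (fun p => u p 1 - (β * p 0 ^ n - lam * k * p 1 * p 0 ^ (k - 1)))
      =o[𝓝[{p | u p 0 = 0}] 0] fun p => p 0 ^ m := by
  have hy := hu.isBigO_snd_of_fst_eq_zero hα
  obtain ⟨f, -, -, -, g, g₁, g₂, g₃, hu, -, -, -, -, hg, hg₁, hg₂, hg₃⟩ := hu
  simp only [← abs_pow, isBigO_abs_right] at hg₁ hg₂
  have hpow : (fun p : Plane => p 0 ^ (2 * k)) =o[𝓝[{p | u p 0 = 0}] 0] fun p => p 0 ^ m :=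
    (Plane.isLittleO_coord_pow hmk 0).mono nhdsWithin_le_nhds
  have h₁ : g₁ =o[𝓝[{p | u p 0 = 0}] 0] fun p => p 0 ^ m :=
    (hg₁.trans_isLittleO (Plane.isLittleO_coord_pow (Nat.lt_succ_of_le hmn) 0)).mono
      nhdsWithin_le_nhds
  have h₂ : (fun p => p 1 * g₂ p) =o[𝓝[{p | u p 0 = 0}] 0] fun p => p 0 ^ m := by
    refine (hy.mul (hg₂.mono nhdsWithin_le_nhds)).trans_isLittleO ?_
    simpa only [← pow_add, ← two_mul] using hpow
  have h₃ : g₃ =o[𝓝[{p | u p 0 = 0}] 0] fun p => p 0 ^ m := by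
    refine ((hg₃.mono nhdsWithin_le_nhds).trans (hy.pow 2)).trans_isLittleO ?_
    simpa only [← pow_mul'] using hpow
  refine ((h₁.add h₂).add h₃).congr' ?_ EventuallyEq.rfl
  filter_upwards [nhdsWithin_le_nhds hu, nhdsWithin_le_nhds hg] with p hup hgp
  simp [hup, hgp]

theorem isEquivalent_snd_of_fst_eq_zero (hu : HasTaylorForm u α β lam n k) (hα : α ≠ 0)
    (hc : c ≠ 0) (hmn : m ≤ n) (hmk : m < 2 * k)
    (hlead : (fun x : ℝ => β * x ^ n + lam ^ 2 * k / α * x ^ (2 * k - 1)) ~[𝓝 0]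
      fun x => c * x ^ m) :
    (fun p => u p 1) ~[𝓝[{p | u p 0 = 0}] 0] fun p => c * p 0 ^ m := by
  have hk : 1 ≤ k := by omega
  have hpow : (fun p : Plane => p 0 ^ (k - 1) * p 0 ^ k) =O[𝓝[{p | u p 0 = 0}] 0]
      fun p => p 0 ^ m := by
    simp only [← pow_add, show k - 1 + k = 2 * k - 1 by omega]
    rcases (Nat.le_sub_one_of_lt hmk).eq_or_lt with rfl | hlt
    · exact isBigO_refl _ _
    · exact ((Plane.isLittleO_coord_pow hlt 0).mono nhdsWithin_le_nhds).isBigO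
  have hcurve : (fun p => -(lam * k) * (p 0 ^ (k - 1) * (p 1 + lam / α * p 0 ^ k)))
      =o[𝓝[{p | u p 0 = 0}] 0] fun p => p 0 ^ m :=
    (((isBigO_refl _ _).mul_isLittleO (hu.isLittleO_snd_of_fst_eq_zero hα)).trans_isBigO
      hpow).const_mul_left _
  have hlead' := ((isLittleO_const_mul_right_iff hc).1 hlead.isLittleO).comp_tendsto
    ((Plane.tendsto_coord 0).mono_left (nhdsWithin_le_nhds (s := {p | u p 0 = 0})))
  refine (isLittleO_const_mul_right_iff hc).2 ((((hu.isLittleO_snd_remainder hα hmn hmk).add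
    hcurve).add hlead').congr_left fun p => ?_)
  simp only [Function.comp_apply, Pi.sub_apply, show 2 * k - 1 = k - 1 + k by omega, pow_add]
  ring

theorem hasIndex (hu : HasTaylorForm u α β lam n k) (hcont : ∀ᶠ p in 𝓝 0, ContinuousAt u p)
    (hα : α ≠ 0) (hc : c ≠ 0) (hm : m ≠ 0) (hmn : m ≤ n) (hmk : m < 2 * k)
    (hlead : (fun x : ℝ => β * x ^ n + lam ^ 2 * k / α * x ^ (2 * k - 1)) ~[𝓝 0]
      fun x => c * x ^ m) :
    HasIndex u 0 (if Even m then 0 else -SignType.sign (α * c)) := by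
  have hk : k ≠ 0 := by omega
  refine (hasIndex_pow hα hc hm).of_sign hcont (hu.map_zero (by omega) hk) ?_ ?_
  · have hpos := eventually_mul_pos_of_isEquivalent
      (hu.isEquivalent_snd_of_fst_eq_zero hα hc hmn hmk hlead)
    have hy := (hu.isBigO_snd_of_fst_eq_zero hα).eq_zero_imp
    rw [eventually_nhdsWithin_iff] at hpos hy ⊢
    filter_upwards [hpos, hy] with p hpos hy hp hup
    refine hpos hup (mul_ne_zero hc (pow_ne_zero m fun hx => hp ?_))
    exact Plane.eq_zero hx (hy hup (by simp [hx, hk]))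
  · have hpos := eventually_mul_pos_of_isEquivalent (hu.isEquivalent_fst_on_axis hα hk)
    rw [eventually_nhdsWithin_iff] at hpos ⊢
    filter_upwards [hpos] with p hpos hp hwp
    have hx : p 0 = 0 := by simpa [hc, hm] using hwp
    exact hpos hx (mul_ne_zero hα fun hy => hp (Plane.eq_zero hx hy))

theorem hasIndex_of_lt_two_mul (hu : HasTaylorForm u α β lam n k)
    (hcont : ∀ᶠ p in 𝓝 0, ContinuousAt u p) (hα : α ≠ 0) (hβ : β ≠ 0) (hn : n ≠ 0)
    (h : n + 1 < 2 * k) : HasIndex u 0 (if Even n then 0 else -SignType.sign (α * β)) := by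
  refine hu.hasIndex hcont hα hβ hn le_rfl (by omega) (IsEquivalent.refl.add_isLittleO ?_)
  exact (isLittleO_const_mul_right_iff hβ).2
    ((isLittleO_pow_pow (show n < 2 * k - 1 by omega)).const_mul_left _)

theorem hasIndex_of_two_mul_eq (hu : HasTaylorForm u α β lam n k)
    (hcont : ∀ᶠ p in 𝓝 0, ContinuousAt u p) (hα : α ≠ 0) (hne : lam ^ 2 * k + α * β ≠ 0)
    (h : 2 * k = n + 1) : HasIndex u 0 (-SignType.sign (lam ^ 2 * k + α * β)) := by
  have hαc : α * (β + lam ^ 2 * k / α) = lam ^ 2 * k + α * β := by field_simp; ring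
  have hc : β + lam ^ 2 * k / α ≠ 0 := right_ne_zero_of_mul (hαc.trans_ne hne)
  have hodd : ¬Even n := by grind
  have hind := hu.hasIndex hcont hα hc (by omega) le_rfl (by omega)
    (by simp only [h, Nat.add_sub_cancel, ← add_mul]; rfl)
  rwa [if_neg hodd, hαc] at hind

theorem hasIndex_of_two_mul_lt (hu : HasTaylorForm u α β lam n k)
    (hcont : ∀ᶠ p in 𝓝 0, ContinuousAt u p) (hα : α ≠ 0) (hlam : lam ≠ 0) (hk : k ≠ 0)
    (h : 2 * k < n + 1) : HasIndex u 0 (-1) := by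
  have hαc : α * (lam ^ 2 * k / α) = lam ^ 2 * k := by field_simp
  have hpos : 0 < lam ^ 2 * (k : ℝ) := by positivity
  have hc : lam ^ 2 * k / α ≠ 0 := div_ne_zero hpos.ne' hα
  have hodd : ¬Even (2 * k - 1) := by grind
  have hlead : (fun x : ℝ => β * x ^ n) =o[𝓝 0] fun x => lam ^ 2 * k / α * x ^ (2 * k - 1) :=
    (isLittleO_const_mul_right_iff hc).2
      ((isLittleO_pow_pow (show 2 * k - 1 < n by omega)).const_mul_left _)
  have hind := hu.hasIndex hcont hα hc (by omega) (by omega) (by omega)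
    (hlead.add_isEquivalent IsEquivalent.refl)
  rwa [if_neg hodd, hαc, sign_pos hpos] at hind

end HasTaylorForm

theorem lemma2p1_general (u : Plane → Plane) (α β lam : ℝ) (n k : ℕ)
    (hα : α ≠ 0) (hn : n ≠ 0) (hk : k ≠ 0)
    (hcont : ∀ᶠ p in 𝓝 (0 : Plane), ContinuousAt u p)
    (hu : HasTaylorForm u α β lam n k) :
    (2 * k > n + 1 → Even n → β ≠ 0 → HasIndex u 0 0) ∧
    (2 * k > n + 1 → Odd n → α * β > 0 → HasIndex u 0 (-1)) ∧
    (2 * k > n + 1 → Odd n → α * β < 0 → HasIndex u 0 1) ∧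
    (2 * k = n + 1 → lam ^ 2 * k + α * β > 0 → HasIndex u 0 (-1)) ∧
    (2 * k = n + 1 → lam ^ 2 * k + α * β < 0 → HasIndex u 0 1) ∧
    (2 * k < n + 1 → lam ≠ 0 → HasIndex u 0 (-1)) := by
  refine ⟨fun h heven hβ => ?_, fun h hodd hpos => ?_, fun h hodd hneg => ?_,
    fun h hpos => ?_, fun h hneg => ?_,
    fun h hlam => hu.hasIndex_of_two_mul_lt hcont hα hlam hk h⟩
  · simpa [heven] using hu.hasIndex_of_lt_two_mul hcont hα hβ hn h
  · simpa [Nat.not_even_iff_odd.2 hodd, hpos] using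
      hu.hasIndex_of_lt_two_mul hcont hα (right_ne_zero_of_mul hpos.ne') hn h
  · simpa [Nat.not_even_iff_odd.2 hodd, hneg] using
      hu.hasIndex_of_lt_two_mul hcont hα (right_ne_zero_of_mul hneg.ne) hn h
  · simpa [hpos] using hu.hasIndex_of_two_mul_eq hcont hα hpos.ne' h
  · simpa [hneg] using hu.hasIndex_of_two_mul_eq hcont hα hneg.ne h

theorem lemma2p1 (u : Plane → Plane) (α β lam : ℝ) (n k : ℕ)
    (hα : α ≠ 0) (hβ : β ≠ 0) (hlam : lam ≠ 0) (hn : 2 ≤ n) (hk : 2 ≤ k)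
    (hcont : ∀ᶠ p in 𝓝 (0 : Plane), ContinuousAt u p)
    (hu : HasTaylorForm u α β lam n k) :
    (2 * k > n + 1 → Even n → HasIndex u 0 0) ∧
    (2 * k > n + 1 → Odd n → α * β > 0 → HasIndex u 0 (-1)) ∧
    (2 * k > n + 1 → Odd n → α * β < 0 → HasIndex u 0 1) ∧
    (2 * k = n + 1 → lam ^ 2 * k + α * β > 0 → HasIndex u 0 (-1)) ∧
    (2 * k = n + 1 → lam ^ 2 * k + α * β < 0 → HasIndex u 0 1) ∧
    (2 * k < n + 1 → HasIndex u 0 (-1)) := by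
  simpa only [hβ, hlam, ne_eq, not_false_eq_true, forall_const] using
    lemma2p1_general u α β lam n k hα (by omega) (by omega) hcont hu
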